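/- \textbf{Theorem (Adequacy).} For every quantum program statement $\mathtt{stm}$ and every expectation $f:\mathtt{St}\to\mathbb{R}^{+\infty}=[0,\infty]$ we have $\mathrm{qwp}[\mathtt{stm}](f)=\mathrm{qet}[\mathtt{stm}]\{f\}$ as functions $\mathtt{St}\to\mathbb{R}^{+\infty}$, where the notions are as follows. \emph{Programs.} Fix a set of Boolean variables, a set of number variables, qubits $q_1,\dots,q_n$, and a set of quantum gates $\mathtt{U}$, each with an arity and an associated unitary matrix $U$. Statements are $$\mathtt{skip}\mid x:=e\mid \mathtt{stm}_1;\mathtt{stm}_2\mid \mathtt{if}\ b\ \mathtt{then}\ \mathtt{stm}_1\ \mathtt{else}\ \mathtt{stm}_0\mid \mathtt{while}\ b\ \mathtt{do}\ \mathtt{stm}\mid \bar q \mathrel{*}= \mathtt{U}\mid x:=\mathtt{meas}\ q_i,$$ where $e$ is an expression of the type of $x$ (in a measurement, $x$ is Boolean), $b$ is a Boolean expression, and $\bar q$ is a sequence of distinct qubits. Number expressions are built from number variables and constants in $\mathbb{N}$ with $+$, truncated $-$ and $\times$; Boolean expressions from Boolean variables, $\mathtt{tt}$, $\mathtt{ff}$,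 and $=$ and $<$ between number expressions, with $\neg,\wedge,\vee$. \emph{States.} $\mathtt{St}$ is the set of pairs $(s,\rho)$ of a store $s$ (assigning to Boolean variables values in $\{0,1\}$ and to number variables values in $\mathbb{N}$) and a density operator $\rho$ on $(\mathbb{C}^2)^{\otimes n}$ (a positive semi-definite matrix of trace $1$). $[\![e]\!]_s$ is the value of $e$ in $s$. Let $\Phi_{U_{\bar q}}(\rho)=U_{\bar q}\rho U_{\bar q}^\dagger$, where $U_{\bar q}$ is $U$ acting on $\bar q$ and the identity on the other qubits. Let $M_{0,i}=I_{2^{i-1}}\otimes|0\rangle\langle 0|\otimes I_{2^{n-i}}$, $M_{1,i}=I-M_{0,i}$, $p_{k,i}(\rho)=\mathrm{tr}(M_{k,i}\rho M_{k,i}^\dagger)=\mathrm{tr}(M_{k,i}\rho)$, and let $m_{k,i}(\rho)=M_{k,i}\rho M_{k,i}^\dagger/\mathrm{tr}(M_{k,i}\rho)$ if $\mathrm{tr}(M_{k,i}\rho)\neq 0$ and $m_{k,i}(\rho)=I/2^n$ otherwise. \emph{Operational side.} A probabilistic abstract reduction system (PARS) on a set $A$ is a relation $\to$ between elements of $A$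 and discrete subdistributions on $A$. It is deterministic if every $a$ has at most one $\delta$ with $a\to\delta$; $a$ is terminal if it has none. Write $\{1:a\}$ for the Dirac distribution at $a$. The PARS lifts to subdistributions by the rules: $\{1:a\}\overset{0}{\twoheadrightarrow}\{1:a\}$ if $a$ is terminal; $\{1:a\}\overset{1}{\twoheadrightarrow}\delta$ if $a\to\delta$; and $\sum_i p_i\delta_i\overset{\sum_i p_ic_i}{\twoheadrightarrow}\sum_i p_i\varepsilon_i$ for countable families with $\delta_i\overset{c_i}{\twoheadrightarrow}\varepsilon_i$ for all $i$ and $\sum_i p_i\le 1$. For a deterministic PARS, each $a$ has exactly one infinite reduction $\{1:a\}=\delta_0\twoheadrightarrow\delta_1\twoheadrightarrow\cdots$. The terminal distribution $\mathrm{nf}(a)$ of $a$ is the subdistribution that gives each terminal $b$ the probability $\lim_i\delta_i(b)$ and each non-terminal $b$ the probability $0$. The semantics of programs is the deterministic PARS on configurations $(\mathtt{stm},s,\rho)$, where $\mathtt{stm}$ is a statement or the termination symbol $\downarrow$, given by \begin{itemize} \item $(\mathtt{skip},s,\rho)\to\{1:(\downarrow,s,\rho)\}$; \item $(x:=e,s,\rho)\to\{1:(\downarrow,s[x:=[\![e]\!]_s],\rho)\}$;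 \item $(\bar q \mathrel{*}= \mathtt{U},s,\rho)\to\{1:(\downarrow,s,\Phi_{U_{\bar q}}(\rho))\}$; \item $(x:=\mathtt{meas}\ q_i,s,\rho)\to\{\mathrm{tr}(M_{k,i}\rho):(\downarrow,s[x:=k],m_{k,i}(\rho))\}_{k\in\{0,1\}}$; \item if $(\mathtt{stm}_1,s,\rho)\to\{p_j:(\mathtt{stm}^j,s^j,\rho^j)\}_{j}$ then $(\mathtt{stm}_1;\mathtt{stm}_2,s,\rho)\to\{p_j:(\mathtt{stm}^j;\mathtt{stm}_2,s^j,\rho^j)\}_{j}$, where $\downarrow;\mathtt{stm}_2$ means $\mathtt{stm}_2$; \item $(\mathtt{if}\ b\ \mathtt{then}\ \mathtt{stm}_1\ \mathtt{else}\ \mathtt{stm}_0,s,\rho)\to\{1:(\mathtt{stm}_{[\![b]\!]_s},s,\rho)\}$; \item $(\mathtt{while}\ b\ \mathtt{do}\ \mathtt{stm},s,\rho)\to\{1:(\downarrow,s,\rho)\}$ if $[\![b]\!]_s=0$, and $\to\{1:(\mathtt{stm};\mathtt{while}\ b\ \mathtt{do}\ \mathtt{stm},s,\rho)\}$ if $[\![b]\!]_s=1$.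 \end{itemize} Its terminal objects are the configurations $(\downarrow,s,\rho)$, and $$\mathrm{qwp}[\mathtt{stm}](f)(\sigma)=\sum_{\tau\in\mathtt{St}}\mathrm{nf}(\mathtt{stm},\sigma)(\downarrow,\tau)\cdot f(\tau).$$ \emph{Denotational side.} For $p:\mathtt{St}\to[0,1]$ let $f+_pg=p\cdot f+(1-p)\cdot g$ (pointwise, with $0\cdot\infty=0$). The quantum expectation transformer is defined by recursion on statements: \begin{align*} \mathrm{qet}[\mathtt{skip}]\{f\}&=f,\\ \mathrm{qet}[x:=e]\{f\}(s,\rho)&=f(s[x:=[\![e]\!]_s],\rho),\\ \mathrm{qet}[\mathtt{stm}_1;\mathtt{stm}_2]\{f\}&=\mathrm{qet}[\mathtt{stm}_1]\{\mathrm{qet}[\mathtt{stm}_2]\{f\}\},\\ \mathrm{qet}[\mathtt{if}\ b\ \mathtt{then}\ \mathtt{stm}_1\ \mathtt{else}\ \mathtt{stm}_0]\{f\}&=\mathrm{qet}[\mathtt{stm}_1]\{f\}+_{[\![b]\!]}\mathrm{qet}[\mathtt{stm}_0]\{f\},\\ \mathrm{qet}[\mathtt{while}\ b\ \mathtt{do}\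 \mathtt{stm}]\{f\}&=\mathrm{lfp}\big(\lambda F.\ \mathrm{qet}[\mathtt{stm}]\{F\}+_{[\![b]\!]}f\big),\\ \mathrm{qet}[\bar q \mathrel{*}= \mathtt{U}]\{f\}(s,\rho)&=f(s,\Phi_{U_{\bar q}}(\rho)),\\ \mathrm{qet}[x:=\mathtt{meas}\ q_i]\{f\}&=f_0+_{p_{0,i}}f_1,\qquad f_k(s,\rho)=f(s[x:=k],m_{k,i}(\rho)), \end{align*} where $[\![b]\!]$ is the function $(s,\rho)\mapsto[\![b]\!]_s\in\{0,1\}$, $p_{0,i}$ is regarded as the function $(s,\rho)\mapsto p_{0,i}(\rho)$, and $\mathrm{lfp}$ is the least fixed point for the pointwise order on $\mathtt{St}\to\mathbb{R}^{+\infty}$. -/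

import Mathlib

open scoped ENNReal ComplexOrder Kronecker Matrix
open Filter Topology

noncomputable section

/-! ## Discrete subdistributions -/

/-- Subdistributions on `A`: functions with values in `[0,1]` and total mass at most `1`. Countability
of the support is automatic, see `SubDist.countable_support`. -/
@[ext]
structure SubDist (A : Type*) where
  prob : A → ℝ≥0∞
  tsum_prob_le_one : ∑' a, prob a ≤ 1

namespace SubDist

theorem prob_le_one {A : Type*} (δ : SubDist A) (a : A) : δ.prob a ≤ 1 :=
  (ENNReal.le_tsum a).trans δ.tsum_prob_le_one

theorem countable_support {A : Type*} (δ : SubDist A) : (Function.support δ.prob).Countable :=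
  Summable.countable_support_ennreal (ne_top_of_le_ne_top ENNReal.one_ne_top δ.tsum_prob_le_one)

open Classical in
/-- The Dirac distribution `{1 : a}`. -/
def dirac {A : Type*} (a : A) : SubDist A where
  prob := Pi.single a 1
  tsum_prob_le_one := by rw [tsum_pi_single]

/-- The convex combination `∑ i, p i · δ i`, where `∑ i, p i ≤ 1`. -/
def comb {A ι : Type*} (p : ι → ℝ≥0∞) (hp : ∑' i, p i ≤ 1) (δ : ι → SubDist A) : SubDist A where
  prob a := ∑' i, p i * (δ i).prob a
  tsum_prob_le_one := by
    rw [ENNReal.tsum_comm]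
    refine le_trans (ENNReal.tsum_le_tsum fun i => ?_) hp
    rw [ENNReal.tsum_mul_left]
    exact mul_le_of_le_one_right' (δ i).tsum_prob_le_one

/-- The image `{δ a : g a}` of `δ` under `g`. -/
def map {A A' : Type*} (g : A → A') (δ : SubDist A) : SubDist A' :=
  comb δ.prob δ.tsum_prob_le_one fun a => dirac (g a)

/-- The expectation `𝔼_δ(f) = ∑ a, δ(a) f(a)`. -/
def expect {A : Type*} (δ : SubDist A) (f : A → ℝ≥0∞) : ℝ≥0∞ := ∑' a, δ.prob a * f a

theorem comb_dirac_left {A A' : Type*} (a : A) (h) (κ : A → SubDist A') :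
    comb (dirac a).prob h κ = κ a := by
  classical
  ext b
  change ∑' i, (dirac a).prob i * (κ i).prob b = _
  rw [tsum_eq_single a]
  · simp [dirac]
  · intro c hc
    simp [dirac, Pi.single_eq_of_ne hc]

theorem comb_comb {A A' ι : Type*} (p : ι → ℝ≥0∞) (hp : ∑' i, p i ≤ 1) (δ : ι → SubDist A)
    (κ : A → SubDist A') (h) :
    comb (comb p hp δ).prob h κ
      = comb p hp fun i => comb (δ i).prob (δ i).tsum_prob_le_one κ := by
  ext b
  change ∑' a, (∑' i, p i * (δ i).prob a) * (κ a).prob b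
    = ∑' i, p i * ∑' a, (δ i).prob a * (κ a).prob b
  simp_rw [← ENNReal.tsum_mul_right, ← ENNReal.tsum_mul_left]
  rw [ENNReal.tsum_comm]
  simp_rw [mul_assoc]

end SubDist

/-! ## Probabilistic abstract reduction systems -/

/-- A PARS on `A` is a binary relation between `A` and the subdistributions on `A`. -/
abbrev PARS (A : Type*) := A → SubDist A → Prop

namespace PARS

def Deterministic {A : Type*} (R : PARS A) : Prop :=
  ∀ a δ₁ δ₂, R a δ₁ → R a δ₂ → δ₁ = δ₂

def Terminal {A : Type*} (R : PARS A) (a : A) : Prop := ∀ δ, ¬ R a δ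

/-- The lifting of a PARS to a weighted reduction relation on subdistributions. -/
inductive Lift {A : Type*} (R : PARS A) : SubDist A → ℝ≥0∞ → SubDist A → Prop
  | terminal {a : A} (h : R.Terminal a) : Lift R (.dirac a) 0 (.dirac a)
  | step {a : A} {δ : SubDist A} (h : R a δ) : Lift R (.dirac a) 1 δ
  | sum {ι : Type} [Countable ι] (p : ι → ℝ≥0∞) (hp : ∑' i, p i ≤ 1) (δ ε : ι → SubDist A)
      (c : ι → ℝ≥0∞) (h : ∀ i, Lift R (δ i) (c i) (ε i)) :
      Lift R (.comb p hp δ) (∑' i, p i * c i) (.comb p hp ε)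

/-- `δ` is an infinite reduction `{1 : a} = δ 0 ⇝ δ 1 ⇝ δ 2 ⇝ ⋯`, with weights `c`. -/
def IsReduction {A : Type*} (R : PARS A) (a : A) (δ : ℕ → SubDist A) (c : ℕ → ℝ≥0∞) : Prop :=
  δ 0 = .dirac a ∧ ∀ i, Lift R (δ i) (c i) (δ (i + 1))

/-- `ν` is the terminal distribution of `a`: for terminal `b`, `ν(b)` is the limit of the
probabilities of `b` along an infinite reduction from `a`; non-terminal objects have probability
`0` in `ν`. -/
def IsTerminalDist {A : Type*} (R : PARS A) (a : A) (ν : SubDist A) : Prop :=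
  ∃ δ c, R.IsReduction a δ c ∧
    (∀ b, R.Terminal b → Tendsto (fun i => (δ i).prob b) atTop (𝓝 (ν.prob b))) ∧
    (∀ b, ¬ R.Terminal b → ν.prob b = 0)

open Classical in
/-- Auxiliary: the one-step reduct of `a`, which is `{1 : a}` if `a` is terminal. -/
def next {A : Type*} (R : PARS A) (a : A) : SubDist A :=
  if h : ∃ δ, R a δ then h.choose else .dirac a

theorem next_of_terminal {A : Type*} {R : PARS A} {a : A} (h : R.Terminal a) :
    R.next a = .dirac a := by
  have h' : ¬ ∃ δ, R a δ := fun ⟨δ, hδ⟩ => h δ hδ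
  simp [next, h']

theorem next_of_step {A : Type*} {R : PARS A} (hR : R.Deterministic) {a : A} {δ : SubDist A}
    (h : R a δ) : R.next a = δ := by
  have h' : ∃ δ, R a δ := ⟨δ, h⟩
  rw [next, dif_pos h']
  exact hR _ _ _ h'.choose_spec h

theorem Lift.eq_comb_next {A : Type*} {R : PARS A} (hR : R.Deterministic) {δ ε : SubDist A}
    {c : ℝ≥0∞} (h : Lift R δ c ε) : ε = .comb δ.prob δ.tsum_prob_le_one R.next := by
  induction h with
  | terminal h => rw [SubDist.comb_dirac_left, next_of_terminal h]
  | step h => rw [SubDist.comb_dirac_left, next_of_step hR h]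
  | sum p hp δ ε c h ih =>
    rw [SubDist.comb_comb]
    congr 1
    exact funext ih

theorem exists_lift {A : Type*} (R : PARS A) (δ : SubDist A) :
    ∃ c, Lift R δ c (.comb δ.prob δ.tsum_prob_le_one R.next) := by
  classical
  have hone : ∀ a, ∃ c, Lift R (.dirac a) c (R.next a) := by
    intro a
    by_cases h : ∃ δ, R a δ
    · refine ⟨1, .step ?_⟩
      rw [next, dif_pos h]
      exact h.choose_spec
    · have h' : R.Terminal a := fun δ hδ => h ⟨δ, hδ⟩
      rw [next_of_terminal h']
      exact ⟨0, .terminal h'⟩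
  choose w hw using hone
  have : Countable (Function.support δ.prob) := δ.countable_support.to_subtype
  let e := (equivShrink.{0} (Function.support δ.prob)).symm
  have key : ∀ g : A → ℝ≥0∞, ∑' i, δ.prob (e i) * g (e i) = ∑' a, δ.prob a * g a := by
    intro g
    rw [e.tsum_eq (fun x : Function.support δ.prob => δ.prob x * g x)]
    refine tsum_subtype_eq_of_support_subset (f := fun a => δ.prob a * g a) ?_
    intro a ha h0
    exact ha (by simp [h0])
  have hp : ∑' i, δ.prob (e i) ≤ 1 := by
    have := key fun _ => 1
    simp only [mul_one] at this
    rw [this]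
    exact δ.tsum_prob_le_one
  have : Countable (Shrink.{0} (Function.support δ.prob)) := e.countable_iff.2 inferInstance
  have h := Lift.sum (R := R) (fun i => δ.prob (e i)) hp (fun i => .dirac (e i).1)
    (fun i => R.next (e i)) (fun i => w (e i)) fun i => hw _
  have h1 : SubDist.comb (fun i => δ.prob (e i)) hp (fun i => .dirac (e i).1) = δ := by
    ext b
    refine (key fun a => (SubDist.dirac a).prob b).trans ?_
    rw [tsum_eq_single b]
    · simp [SubDist.dirac]
    · intro a hab
      simp [SubDist.dirac, Pi.single_eq_of_ne hab.symm]
  have h2 : SubDist.comb (fun i => δ.prob (e i)) hp (fun i => R.next (e i))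
      = .comb δ.prob δ.tsum_prob_le_one R.next := by
    ext b
    exact key fun a => (R.next a).prob b
  rw [h1, h2] at h
  exact ⟨_, h⟩

/-- Auxiliary: the infinite reduction from `a`. -/
def reduction {A : Type*} (R : PARS A) (a : A) : ℕ → SubDist A
  | 0 => .dirac a
  | i + 1 => .comb (reduction R a i).prob (reduction R a i).tsum_prob_le_one R.next

theorem IsReduction.eq_reduction {A : Type*} {R : PARS A} (hR : R.Deterministic) {a : A}
    {δ : ℕ → SubDist A} {c : ℕ → ℝ≥0∞} (h : R.IsReduction a δ c) : δ = R.reduction a := by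
  funext i
  induction i with
  | zero => exact h.1
  | succ i ih => rw [(h.2 i).eq_comb_next hR, reduction, ih]

theorem exists_isReduction {A : Type*} (R : PARS A) (a : A) :
    ∃ c, R.IsReduction a (R.reduction a) c := by
  choose c hc using fun i => R.exists_lift (R.reduction a i)
  exact ⟨c, rfl, hc⟩

theorem monotone_reduction {A : Type*} {R : PARS A} (a : A) {b : A} (hb : R.Terminal b) :
    Monotone fun i => (R.reduction a i).prob b := by
  classical
  refine monotone_nat_of_le_succ fun i => ?_
  change _ ≤ ∑' x, (R.reduction a i).prob x * (R.next x).prob b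
  refine le_trans ?_ (ENNReal.le_tsum b)
  rw [next_of_terminal hb]
  simp [SubDist.dirac]

/-- In a deterministic PARS, every object has exactly one terminal distribution. -/
theorem existsUnique_terminalDist {A : Type*} (R : PARS A) (hR : R.Deterministic) (a : A) :
    ∃! ν, R.IsTerminalDist a ν := by
  classical
  obtain ⟨c, hc⟩ := R.exists_isReduction a
  let g : A → ℝ≥0∞ := fun b => if R.Terminal b then ⨆ i, (R.reduction a i).prob b else 0
  have hg : ∀ b, R.Terminal b → Tendsto (fun i => (R.reduction a i).prob b) atTop (𝓝 (g b)) := by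
    intro b hb
    simp only [g, if_pos hb]
    exact tendsto_atTop_iSup (monotone_reduction a hb)
  have hle : ∑' b, g b ≤ 1 := by
    rw [ENNReal.tsum_eq_iSup_sum]
    refine iSup_le fun s => ?_
    have ht : Tendsto (fun i => ∑ b ∈ s, if R.Terminal b then (R.reduction a i).prob b else 0)
        atTop (𝓝 (∑ b ∈ s, g b)) := by
      refine tendsto_finsetSum _ fun b _ => ?_
      by_cases hb : R.Terminal b
      · simpa only [if_pos hb] using hg b hb
      · simp [g, hb]
    refine le_of_tendsto' ht fun i => ?_
    refine le_trans (Finset.sum_le_sum fun b _ => ?_)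
      ((ENNReal.sum_le_tsum s).trans (R.reduction a i).tsum_prob_le_one)
    split_ifs <;> simp
  refine ⟨⟨g, hle⟩, ⟨_, c, hc, hg, fun b hb => by simp [g, hb]⟩, ?_⟩
  rintro ν ⟨δ, c', hred, hlim, hzero⟩
  ext b
  by_cases hb : R.Terminal b
  · have h1 := hlim b hb
    rw [hred.eq_reduction hR] at h1
    exact tendsto_nhds_unique h1 (hg b hb)
  · simp [hzero b hb, g, hb]

/-- The terminal distribution of `a` in a deterministic PARS. -/
def nf {A : Type*} (R : PARS A) (hR : R.Deterministic) (a : A) : SubDist A :=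
  (R.existsUnique_terminalDist hR a).choose

theorem isTerminalDist_nf {A : Type*} (R : PARS A) (hR : R.Deterministic) (a : A) :
    R.IsTerminalDist a (R.nf hR a) :=
  (R.existsUnique_terminalDist hR a).choose_spec.1

/-- The weakest pre-expectation of a deterministic PARS. -/
def wp {A : Type*} (R : PARS A) (hR : R.Deterministic) (f : A → ℝ≥0∞) (a : A) : ℝ≥0∞ :=
  (R.nf hR a).expect f

end PARS

namespace QProg

/-! ## Syntax -/

inductive NExp (V : Type*)
  | var (x : V)
  | const (k : ℕ)
  | add (e₁ e₂ : NExp V)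
  | sub (e₁ e₂ : NExp V)
  | mul (e₁ e₂ : NExp V)

inductive BExp (B V : Type*)
  | var (x : B)
  | tt
  | ff
  | eq (e₁ e₂ : NExp V)
  | lt (e₁ e₂ : NExp V)
  | not (b : BExp B V)
  | and (b₁ b₂ : BExp B V)
  | or (b₁ b₂ : BExp B V)

/-- A set of quantum gates: gate symbols, each with an arity and a unitary matrix on the computational
basis of that many qubits. -/
structure GateSet where
  Gate : Type*
  arity : Gate → ℕ
  mat : (g : Gate) → Matrix.unitaryGroup (Fin (arity g) → Bool) ℂ

/-- Statements over the gates `G`, the Boolean variables `B`, the number variables `V` and the qubits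
`q₁, …, qₙ` (indexed by `Fin n`). A gate acts on a sequence of pairwise distinct qubits. -/
inductive Stmt (G : GateSet) (B V : Type*) (n : ℕ)
  | skip
  | assignB (x : B) (e : BExp B V)
  | assignN (x : V) (e : NExp V)
  | seq (c₁ c₂ : Stmt G B V n)
  | ite (b : BExp B V) (c₁ c₂ : Stmt G B V n)
  | loop (b : BExp B V) (c : Stmt G B V n)
  | apply (g : G.Gate) (q : Fin (G.arity g) ↪ Fin n)
  | meas (x : B) (i : Fin n)

/-! ## Classical and quantum states -/

/-- Well-typed stores: Boolean variables have values in `{0, 1}`, number variables in `ℕ`. -/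
structure Store (B V : Type*) where
  bool : B → Bool
  num : V → ℕ

open Classical in
def Store.setB {B V : Type*} (s : Store B V) (x : B) (k : Bool) : Store B V :=
  { s with bool := Function.update s.bool x k }

open Classical in
def Store.setN {B V : Type*} (s : Store B V) (x : V) (k : ℕ) : Store B V :=
  { s with num := Function.update s.num x k }

/-- Subtraction is truncated at `0`. -/
def NExp.eval {B V : Type*} (s : Store B V) : NExp V → ℕ
  | var x => s.num x
  | const k => k
  | add e₁ e₂ => e₁.eval s + e₂.eval s
  | sub e₁ e₂ => e₁.eval s - e₂.eval s
  | mul e₁ e₂ => e₁.eval s * e₂.eval s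

def BExp.eval {B V : Type*} (s : Store B V) : BExp B V → Bool
  | var x => s.bool x
  | tt => true
  | ff => false
  | eq e₁ e₂ => decide (e₁.eval s = e₂.eval s)
  | lt e₁ e₂ => decide (e₁.eval s < e₂.eval s)
  | not b => !(b.eval s)
  | and b₁ b₂ => b₁.eval s && b₂.eval s
  | or b₁ b₂ => b₁.eval s || b₂.eval s

/-- Complex matrices on the `2 ^ n`-dimensional space of `n` qubits, in the computational basis, which
is indexed by `Fin n → Bool` (`false` for `|0⟩`, `true` for `|1⟩`). -/
abbrev QMat (n : ℕ) := Matrix (Fin n → Bool) (Fin n → Bool) ℂ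

/-- Density operators: positive semi-definite matrices of trace `1`. -/
def Density (n : ℕ) := {ρ : QMat n // ρ.PosSemidef ∧ ρ.trace = 1}

/-- The extension of an `m`-qubit matrix `U` to all `n` qubits: `U` acts on the qubits listed in `q`,
the identity acts on the others. -/
def extend {m n : ℕ} (U : QMat m) (q : Fin m ↪ Fin n) : QMat n :=
  open Classical in
  fun x y => if ∀ j, j ∉ Set.range q → x j = y j then U (x ∘ q) (y ∘ q) else 0

open Classical in
theorem extend_mem_unitary {m n : ℕ} (U : QMat m) (hU : U ∈ Matrix.unitaryGroup (Fin m → Bool) ℂ)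
    (q : Fin m ↪ Fin n) : extend U q ∈ Matrix.unitaryGroup (Fin n → Bool) ℂ := by
  let e₁ : (Fin n → Bool) ≃ _ := Equiv.piEquivPiSubtypeProd (fun j => j ∈ Set.range q) fun _ => Bool
  let e₂ : ({j // j ∈ Set.range q} → Bool) ≃ (Fin m → Bool) :=
    Equiv.arrowCongr (Equiv.ofInjective q q.injective).symm (Equiv.refl _)
  let e := e₁.trans (Equiv.prodCongr e₂ (Equiv.refl ({j // j ∉ Set.range q} → Bool)))
  have h : extend U q
      = (U ⊗ₖ (1 : Matrix ({j // j ∉ Set.range q} → Bool) ({j // j ∉ Set.range q} → Bool) ℂ)).submatrix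
        e e := by
    ext x y
    have hx : ∀ z, (e z).1 = z ∘ q := fun z => rfl
    have hz : ∀ z, (e z).2 = fun j => z j.1 := fun z => rfl
    simp only [Matrix.submatrix_apply, Matrix.kroneckerMap_apply, Matrix.one_apply, hx, hz, extend]
    by_cases hxy : ∀ j, j ∉ Set.range q → x j = y j
    · have h2 : (fun j : {j // j ∉ Set.range q} => x j.1) = fun j => y j.1 :=
        funext fun j => hxy j.1 j.2
      exact (if_pos hxy).trans ((mul_one _).symm.trans (congrArg _ (if_pos h2).symm))
    · have h2 : ¬ (fun j : {j // j ∉ Set.range q} => x j.1) = fun j => y j.1 :=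
        fun hj => hxy fun j hjq => congrFun hj ⟨j, hjq⟩
      exact (if_neg hxy).trans ((mul_zero _).symm.trans (congrArg _ (if_neg h2).symm))
  have hk := Matrix.kronecker_mem_unitary hU
    (one_mem (Matrix.unitaryGroup ({j // j ∉ Set.range q} → Bool) ℂ))
  rw [Matrix.mem_unitaryGroup_iff] at hk ⊢
  rw [h, Matrix.star_eq_conjTranspose, Matrix.conjTranspose_submatrix, Matrix.submatrix_mul_equiv,
    ← Matrix.star_eq_conjTranspose, hk, Matrix.submatrix_one_equiv]

/-- The superoperator `ρ ↦ U ρ U†`. -/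
def Density.conj {n : ℕ} (U : Matrix.unitaryGroup (Fin n → Bool) ℂ) (ρ : Density n) : Density n :=
  ⟨U.1 * ρ.1 * U.1ᴴ, ρ.2.1.mul_mul_conjTranspose_same U.1, by
    rw [Matrix.trace_mul_cycle, ← Matrix.star_eq_conjTranspose,
      Matrix.mem_unitaryGroup_iff'.1 U.2, one_mul, ρ.2.2]⟩

/-- The superoperator of a gate, applied to the qubits listed in `q`. -/
def gateOp {G : GateSet} {n : ℕ} (g : G.Gate) (q : Fin (G.arity g) ↪ Fin n) :
    Density n → Density n :=
  Density.conj ⟨extend (G.mat g).1 q, extend_mem_unitary _ (G.mat g).2 q⟩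

/-- The measurement operators: for outcome `0`, the matrix `I ⊗ |0⟩⟨0| ⊗ I`, with `|0⟩⟨0|` at qubit `i`;
for outcome `1`, its complement. -/
def measMat {n : ℕ} : Bool → Fin n → QMat n
  | false, i => Matrix.diagonal fun x => if x i = false then 1 else 0
  | true, i => 1 - Matrix.diagonal fun x => if x i = false then 1 else 0

theorem measMat_eq {n : ℕ} (k : Bool) (i : Fin n) :
    measMat k i = Matrix.diagonal fun x => if x i = k then 1 else 0 := by
  cases k
  · rfl
  · rw [measMat, ← Matrix.diagonal_one, Matrix.diagonal_sub]
    congr 1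
    funext x
    cases h : x i <;> simp

theorem measMat_conjTranspose_mul_self {n : ℕ} (k : Bool) (i : Fin n) :
    (measMat k i)ᴴ * measMat k i = measMat k i := by
  rw [measMat_eq, Matrix.diagonal_conjTranspose, Matrix.diagonal_mul_diagonal]
  congr 1
  funext x
  by_cases h : x i = k <;> simp [h]

theorem trace_measMat_conj {n : ℕ} (k : Bool) (i : Fin n) (ρ : QMat n) :
    (measMat k i * ρ * (measMat k i)ᴴ).trace = (measMat k i * ρ).trace := by
  rw [Matrix.trace_mul_cycle, measMat_conjTranspose_mul_self]

theorem trace_measMat_nonneg {n : ℕ} (k : Bool) (i : Fin n) (ρ : Density n) :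
    0 ≤ (measMat k i * ρ.1).trace := by
  rw [← trace_measMat_conj]
  exact (ρ.2.1.mul_mul_conjTranspose_same _).trace_nonneg

/-- The probability `tr(M ρ)` of the outcome `k` when qubit `i` is measured. -/
def measProb {n : ℕ} (k : Bool) (i : Fin n) (ρ : Density n) : ℝ≥0∞ :=
  ENNReal.ofReal (measMat k i * ρ.1).trace.re

theorem tsum_measProb {n : ℕ} (i : Fin n) (ρ : Density n) : ∑' k, measProb k i ρ = 1 := by
  rw [tsum_bool, measProb, measProb, ← ENNReal.ofReal_add (Complex.le_def.1 (trace_measMat_nonneg _ i ρ)).1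
    (Complex.le_def.1 (trace_measMat_nonneg _ i ρ)).1, ← Complex.add_re, ← Matrix.trace_add,
    ← Matrix.add_mul, measMat, measMat, add_sub_cancel, one_mul, ρ.2.2]
  simp

theorem posSemidef_maxMixed (n : ℕ) :
    (((2 : ℂ) ^ n)⁻¹ • (1 : QMat n)).PosSemidef ∧ (((2 : ℂ) ^ n)⁻¹ • (1 : QMat n)).trace = 1 := by
  constructor
  · refine Matrix.PosSemidef.one.smul ?_
    positivity
  · rw [Matrix.trace_smul, Matrix.trace_one]
    simp

open Classical in
/-- The normalized state after outcome `k` of a measurement of qubit `i`: `M ρ M† / tr(M ρ)` if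
`tr(M ρ) ≠ 0`, and `I / 2 ^ n` otherwise. -/
def postMeas {n : ℕ} (k : Bool) (i : Fin n) (ρ : Density n) : Density n :=
  if h : (measMat k i * ρ.1).trace ≠ 0 then
    ⟨(measMat k i * ρ.1).trace⁻¹ • (measMat k i * ρ.1 * (measMat k i)ᴴ),
      (ρ.2.1.mul_mul_conjTranspose_same _).smul (inv_nonneg.2 (trace_measMat_nonneg k i ρ)), by
      rw [Matrix.trace_smul, trace_measMat_conj, smul_eq_mul, inv_mul_cancel₀ h]⟩
  else ⟨((2 : ℂ) ^ n)⁻¹ • 1, posSemidef_maxMixed n⟩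

/-! ## Operational semantics -/

/-- States: pairs of a store and a quantum state. -/
abbrev State (B V : Type*) (n : ℕ) := Store B V × Density n

/-- Configurations: pairs of a statement or the termination symbol `↓` (which is `none`), and a
state. -/
abbrev Conf (G : GateSet) (B V : Type*) (n : ℕ) := Option (Stmt G B V n) × State B V n

/-- Sequential composition extended by `↓; c = c`. -/
def seqC {G : GateSet} {B V : Type*} {n : ℕ} (c₁ : Option (Stmt G B V n)) (c₂ : Stmt G B V n) :
    Stmt G B V n :=
  match c₁ with
  | none => c₂
  | some c₁ => .seq c₁ c₂

/-- The reduction rules of quantum programs. -/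
inductive Step {G : GateSet} {B V : Type*} {n : ℕ} : PARS (Conf G B V n)
  | skip (s : Store B V) (ρ : Density n) :
      Step (some .skip, s, ρ) (.dirac (none, s, ρ))
  | assignB (x : B) (e : BExp B V) (s : Store B V) (ρ : Density n) :
      Step (some (.assignB x e), s, ρ) (.dirac (none, s.setB x (e.eval s), ρ))
  | assignN (x : V) (e : NExp V) (s : Store B V) (ρ : Density n) :
      Step (some (.assignN x e), s, ρ) (.dirac (none, s.setN x (e.eval s), ρ))
  | apply (g : G.Gate) (q : Fin (G.arity g) ↪ Fin n) (s : Store B V) (ρ : Density n) :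
      Step (some (.apply g q), s, ρ) (.dirac (none, s, gateOp g q ρ))
  | meas (x : B) (i : Fin n) (s : Store B V) (ρ : Density n) :
      Step (some (.meas x i), s, ρ)
        (.comb (fun k => measProb k i ρ) (tsum_measProb i ρ).le
          fun k => .dirac (none, s.setB x k, postMeas k i ρ))
  | seq (c₁ c₂ : Stmt G B V n) (s : Store B V) (ρ : Density n) (δ : SubDist (Conf G B V n))
      (h : Step (some c₁, s, ρ) δ) :
      Step (some (.seq c₁ c₂), s, ρ) (δ.map fun μ => (some (seqC μ.1 c₂), μ.2))
  | iteTrue (b : BExp B V) (c₁ c₂ : Stmt G B V n) (s : Store B V) (ρ : Density n)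
      (h : b.eval s = true) :
      Step (some (.ite b c₁ c₂), s, ρ) (.dirac (some c₁, s, ρ))
  | iteFalse (b : BExp B V) (c₁ c₂ : Stmt G B V n) (s : Store B V) (ρ : Density n)
      (h : b.eval s = false) :
      Step (some (.ite b c₁ c₂), s, ρ) (.dirac (some c₂, s, ρ))
  | loopFalse (b : BExp B V) (c : Stmt G B V n) (s : Store B V) (ρ : Density n)
      (h : b.eval s = false) :
      Step (some (.loop b c), s, ρ) (.dirac (none, s, ρ))
  | loopTrue (b : BExp B V) (c : Stmt G B V n) (s : Store B V) (ρ : Density n)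
      (h : b.eval s = true) :
      Step (some (.loop b c), s, ρ) (.dirac (some (.seq c (.loop b c)), s, ρ))

theorem step_deterministic {G : GateSet} {B V : Type*} {n : ℕ} :
    (Step (G := G) (B := B) (V := V) (n := n)).Deterministic := by
  intro μ δ₁ δ₂ h₁
  induction h₁ generalizing δ₂ with
  | seq c₁ c₂ s ρ δ h ih =>
    intro h₂
    cases h₂ with
    | seq _ _ _ _ δ' h' => rw [ih _ h']
  | _ =>
    intro h₂
    cases h₂ <;> simp_all

/-- The terminal objects are precisely the configurations `(↓, s, ρ)`. -/
theorem terminal_step_iff {G : GateSet} {B V : Type*} {n : ℕ} (μ : Conf G B V n) :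
    PARS.Terminal Step μ ↔ μ.1 = none := by
  obtain ⟨c, s, ρ⟩ := μ
  constructor
  · intro h
    cases c with
    | none => rfl
    | some c =>
      exfalso
      suffices ∃ δ, Step (some c, s, ρ) δ from this.elim fun δ hδ => h δ hδ
      clear h
      induction c with
      | skip => exact ⟨_, .skip s ρ⟩
      | assignB x e => exact ⟨_, .assignB x e s ρ⟩
      | assignN x e => exact ⟨_, .assignN x e s ρ⟩
      | seq c₁ c₂ ih₁ _ => exact ih₁.elim fun δ hδ => ⟨_, .seq c₁ c₂ s ρ δ hδ⟩
      | ite b c₁ c₂ =>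
        cases hb : b.eval s
        · exact ⟨_, .iteFalse b c₁ c₂ s ρ hb⟩
        · exact ⟨_, .iteTrue b c₁ c₂ s ρ hb⟩
      | loop b c =>
        cases hb : b.eval s
        · exact ⟨_, .loopFalse b c s ρ hb⟩
        · exact ⟨_, .loopTrue b c s ρ hb⟩
      | apply g q => exact ⟨_, .apply g q s ρ⟩
      | meas x i => exact ⟨_, .meas x i s ρ⟩
  · intro h δ hδ
    obtain rfl : c = none := h
    cases hδ

/-- The operational weakest pre-expectation of a statement. -/
def qwp {G : GateSet} {B V : Type*} {n : ℕ} (c : Stmt G B V n) (f : State B V n → ℝ≥0∞) :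
    State B V n → ℝ≥0∞ :=
  fun σ => PARS.wp Step step_deterministic (fun μ => f μ.2) (some c, σ)

/-! ## The quantum expectation transformer -/

/-- `f +_p g = p · f + (1 - p) · g`, for `p` with values in `[0, 1]`. -/
def mix {S : Type*} (p f g : S → ℝ≥0∞) : S → ℝ≥0∞ := fun σ => p σ * f σ + (1 - p σ) * g σ

theorem mix_mono {S : Type*} (p : S → ℝ≥0∞) {f f' g g' : S → ℝ≥0∞} (hf : f ≤ f') (hg : g ≤ g') :
    mix p f g ≤ mix p f' g' := fun σ =>
  add_le_add (mul_le_mul_right (hf σ) _) (mul_le_mul_right (hg σ) _)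

/-- The value of a Boolean expression, seen as a function with values in `{0, 1}`. -/
def guard {B V : Type*} {n : ℕ} (b : BExp B V) : State B V n → ℝ≥0∞ :=
  fun σ => if b.eval σ.1 = true then 1 else 0

/-- The probability `tr(M ρ M†)`, as a function of the state. -/
def outcomeProb {B V : Type*} {n : ℕ} (k : Bool) (i : Fin n) : State B V n → ℝ≥0∞ :=
  fun σ => ENNReal.ofReal (measMat k i * σ.2.1 * (measMat k i)ᴴ).trace.re

/-- The loop functional `F ↦ T F +_b f`. -/
def loopFun {B V : Type*} {n : ℕ} (b : BExp B V)
    (T : (State B V n → ℝ≥0∞) →o (State B V n → ℝ≥0∞)) (f : State B V n → ℝ≥0∞) :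
    (State B V n → ℝ≥0∞) →o (State B V n → ℝ≥0∞) where
  toFun F := mix (guard b) (T F) f
  monotone' _ _ h := mix_mono _ (T.monotone h) le_rfl

/-- The quantum expectation transformer. It is defined together with its monotonicity, so that the
least fixed points of the loop functionals in the complete lattice of expectations (ordered
pointwise) exist. -/
def qet {G : GateSet} {B V : Type*} {n : ℕ} :
    Stmt G B V n → (State B V n → ℝ≥0∞) →o (State B V n → ℝ≥0∞)
  | .skip => OrderHom.id
  | .assignB x e =>
      { toFun := fun f σ => f (σ.1.setB x (e.eval σ.1), σ.2)
        monotone' := fun _ _ h _ => h _ }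
  | .assignN x e =>
      { toFun := fun f σ => f (σ.1.setN x (e.eval σ.1), σ.2)
        monotone' := fun _ _ h _ => h _ }
  | .seq c₁ c₂ => (qet c₁).comp (qet c₂)
  | .ite b c₁ c₂ =>
      { toFun := fun f => mix (guard b) (qet c₁ f) (qet c₂ f)
        monotone' := fun _ _ h => mix_mono _ ((qet c₁).monotone h) ((qet c₂).monotone h) }
  | .loop b c =>
      { toFun := fun f => OrderHom.lfp (loopFun b (qet c) f)
        monotone' := fun _ _ h => OrderHom.lfp.monotone fun _ => mix_mono _ le_rfl h }
  | .apply g q =>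
      { toFun := fun f σ => f (σ.1, gateOp g q σ.2)
        monotone' := fun _ _ h _ => h _ }
  | .meas x i =>
      { toFun := fun f =>
          mix (outcomeProb false i)
            (fun σ => f (σ.1.setB x false, postMeas false i σ.2))
            (fun σ => f (σ.1.setB x true, postMeas true i σ.2))
        monotone' := fun _ _ h => mix_mono _ (fun _ => h _) (fun _ => h _) }

end QProg

end

/-!
On configurations, the weakest pre-expectation of a deterministic PARS is the least function that
dominates the post-expectation on terminal objects and does not increase in expectation along
steps. Extended to configurations, `qet` is preserved in expectation by every step, so leastness
gives `qwp ≤ qet`. The converse is an induction on the statement: for a loop, `qwp` is a pre-fixed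
point of the loop functional, because `qwp c₁ (qwp c₂ f) ≤ qwp (c₁; c₂) f`, again by leastness.
-/

namespace SubDist

variable {A A' : Type*}

theorem expect_mono (δ : SubDist A) {f g : A → ℝ≥0∞} (h : f ≤ g) : δ.expect f ≤ δ.expect g :=
  ENNReal.tsum_le_tsum fun a => mul_le_mul_right (h a) _

theorem expect_comb {ι : Type*} (p : ι → ℝ≥0∞) (hp : ∑' i, p i ≤ 1) (δ : ι → SubDist A)
    (f : A → ℝ≥0∞) : (comb p hp δ).expect f = ∑' i, p i * (δ i).expect f := by
  simp only [expect, comb, ← ENNReal.tsum_mul_right, ← ENNReal.tsum_mul_left, mul_assoc]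
  exact ENNReal.tsum_comm

theorem expect_dirac (a : A) (f : A → ℝ≥0∞) : (dirac a).expect f = f a := by
  classical
  rw [expect, tsum_eq_single a fun b hb => by simp [dirac, Pi.single_eq_of_ne hb]]
  simp [dirac]

theorem expect_map (g : A → A') (δ : SubDist A) (f : A' → ℝ≥0∞) :
    (δ.map g).expect f = δ.expect (f ∘ g) := by
  rw [map, expect_comb]
  simp only [expect_dirac]
  rfl

end SubDist

section iSup

variable {A ι : Type*} [Preorder ι] [IsDirectedOrder ι] {f : ι → A → ℝ≥0∞}

theorem tsum_iSup_of_monotone (hf : ∀ a, Monotone (f · a)) :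
    ∑' a, ⨆ k, f k a = ⨆ k, ∑' a, f k a := by
  simp only [ENNReal.tsum_eq_iSup_sum, ENNReal.finsetSum_iSup_of_monotone hf]
  exact iSup_comm

theorem SubDist.expect_iSup (δ : SubDist A) (hf : ∀ a, Monotone (f · a)) :
    δ.expect (fun a => ⨆ k, f k a) = ⨆ k, δ.expect (f k) := by
  simp only [expect, ENNReal.mul_iSup]
  exact tsum_iSup_of_monotone fun a _ _ h => mul_le_mul_right (hf a h) _

end iSup

namespace PARS

variable {A : Type*} {R : PARS A}

theorem expect_reduction_succ (F : A → ℝ≥0∞) (a : A) (k : ℕ) :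
    (R.reduction a (k + 1)).expect F = (R.reduction a k).expect fun b => (R.next b).expect F :=
  SubDist.expect_comb _ _ _ _

theorem expect_reduction_succ' (F : A → ℝ≥0∞) (a : A) (k : ℕ) :
    (R.reduction a (k + 1)).expect F = (R.next a).expect fun b => (R.reduction b k).expect F := by
  induction k generalizing F with
  | zero =>
    rw [expect_reduction_succ]
    simp only [reduction, SubDist.expect_dirac]
  | succ k ih =>
    rw [expect_reduction_succ, ih]
    simp only [expect_reduction_succ]

theorem monotone_reduction_mul_indicator (f : A → ℝ≥0∞) (a b : A) :
    Monotone fun k => (R.reduction a k).prob b * {b | R.Terminal b}.indicator f b := by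
  by_cases hb : R.Terminal b
  · exact fun _ _ h => mul_le_mul_left (monotone_reduction a hb h) _
  · simp [hb, monotone_const]

theorem monotone_expect_reduction (f : A → ℝ≥0∞) (a : A) :
    Monotone fun k => (R.reduction a k).expect ({b | R.Terminal b}.indicator f) :=
  fun _ _ h => ENNReal.tsum_le_tsum fun b => monotone_reduction_mul_indicator f a b h

theorem nf_prob_of_terminal (hR : R.Deterministic) (a : A) {b : A} (hb : R.Terminal b) :
    (R.nf hR a).prob b = ⨆ k, (R.reduction a k).prob b := by
  obtain ⟨δ, c, hred, hlim, -⟩ := R.isTerminalDist_nf hR a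
  obtain rfl := hred.eq_reduction hR
  exact tendsto_nhds_unique (hlim b hb) (tendsto_atTop_iSup (monotone_reduction a hb))

theorem nf_prob_of_not_terminal (hR : R.Deterministic) (a : A) {b : A} (hb : ¬ R.Terminal b) :
    (R.nf hR a).prob b = 0 :=
  let ⟨_, _, _, _, hzero⟩ := R.isTerminalDist_nf hR a
  hzero b hb

variable (hR : R.Deterministic) (f : A → ℝ≥0∞)

theorem wp_eq_iSup_expect_reduction (a : A) :
    R.wp hR f a = ⨆ k, (R.reduction a k).expect ({b | R.Terminal b}.indicator f) := by
  have nf_mul (b : A) : (R.nf hR a).prob b * f b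
      = ⨆ k, (R.reduction a k).prob b * {b | R.Terminal b}.indicator f b := by
    by_cases hb : R.Terminal b
    · simp [hb, nf_prob_of_terminal hR a hb, ENNReal.iSup_mul]
    · simp [hb, nf_prob_of_not_terminal hR a hb]
  rw [wp, SubDist.expect, tsum_congr nf_mul,
    tsum_iSup_of_monotone (monotone_reduction_mul_indicator f a)]
  rfl

theorem wp_of_step {a : A} {δ : SubDist A} (h : R a δ) : R.wp hR f a = δ.expect (R.wp hR f) := by
  simp only [funext (wp_eq_iSup_expect_reduction hR f)]
  rw [SubDist.expect_iSup δ (monotone_expect_reduction f),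
    ← (monotone_expect_reduction f a).iSup_nat_add 1]
  simp only [expect_reduction_succ', next_of_step hR h]

theorem wp_of_terminal {a : A} (h : R.Terminal a) : R.wp hR f a = f a := by
  have expect_reduction (k : ℕ) :
      (R.reduction a k).expect ({b | R.Terminal b}.indicator f) = f a := by
    induction k with
    | zero => simp [reduction, SubDist.expect_dirac, h]
    | succ k ih => rw [expect_reduction_succ', next_of_terminal h, SubDist.expect_dirac, ih]
  simp only [wp_eq_iSup_expect_reduction, expect_reduction, iSup_const]

variable {f}

theorem wp_le {F : A → ℝ≥0∞} (hterm : ∀ a, R.Terminal a → f a ≤ F a)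
    (hstep : ∀ a δ, R a δ → δ.expect F ≤ F a) : R.wp hR f ≤ F := by
  have indicator_le : {b | R.Terminal b}.indicator f ≤ F := Set.indicator_le hterm
  have expect_next_le (b : A) : (R.next b).expect F ≤ F b := by
    by_cases hb : R.Terminal b
    · rw [next_of_terminal hb, SubDist.expect_dirac]
    · obtain ⟨δ, hδ⟩ : ∃ δ, R b δ := by simpa only [Terminal, not_forall, not_not] using hb
      simpa only [next_of_step hR hδ] using hstep b δ hδ
  have expect_reduction_le (a : A) (k : ℕ) : (R.reduction a k).expect F ≤ F a := by
    induction k with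
    | zero => rw [reduction, SubDist.expect_dirac]
    | succ k ih =>
      rw [expect_reduction_succ]
      exact (SubDist.expect_mono _ expect_next_le).trans ih
  intro a
  rw [wp_eq_iSup_expect_reduction]
  exact iSup_le fun k => (SubDist.expect_mono _ indicator_le).trans (expect_reduction_le a k)

end PARS

namespace QProg

variable {G : GateSet} {B V : Type*} {n : ℕ}

theorem mix_guard_of_true {b : BExp B V} {σ : State B V n} (hb : b.eval σ.1 = true)
    (f g : State B V n → ℝ≥0∞) : mix (guard b) f g σ = f σ := by
  simp [mix, guard, hb]

theorem mix_guard_of_false {b : BExp B V} {σ : State B V n} (hb : b.eval σ.1 = false)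
    (f g : State B V n → ℝ≥0∞) : mix (guard b) f g σ = g σ := by
  simp [mix, guard, hb]

theorem outcomeProb_eq_measProb (k : Bool) (i : Fin n) (σ : State B V n) :
    outcomeProb k i σ = measProb k i σ.2 := by
  rw [outcomeProb, trace_measMat_conj, measProb]

theorem one_sub_measProb_false (i : Fin n) (ρ : Density n) :
    1 - measProb false i ρ = measProb true i ρ := by
  rw [← tsum_measProb i ρ, tsum_bool]
  exact ENNReal.add_sub_cancel_left ENNReal.ofReal_ne_top

theorem qet_meas_apply (x : B) (i : Fin n) (f : State B V n → ℝ≥0∞) (σ : State B V n) :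
    qet (G := G) (.meas x i) f σ
      = ∑' k, measProb k i σ.2 * f (σ.1.setB x k, postMeas k i σ.2) := by
  rw [tsum_bool, ← one_sub_measProb_false, ← outcomeProb_eq_measProb]
  rfl

theorem qet_loop_eq_mix (b : BExp B V) (c : Stmt G B V n) (f : State B V n → ℝ≥0∞) :
    qet (.loop b c) f = mix (guard b) (qet c (qet (.loop b c) f)) f :=
  (loopFun b (qet c) f).map_lfp.symm

/-- The quantum expectation transformer extended to configurations, by `f` itself at `↓`. -/
noncomputable def confQet (f : State B V n → ℝ≥0∞) : Conf G B V n → ℝ≥0∞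
  | (none, σ) => f σ
  | (some c, σ) => qet c f σ

theorem confQet_seqC (c : Stmt G B V n) (f : State B V n → ℝ≥0∞) (μ : Conf G B V n) :
    confQet f (some (seqC μ.1 c), μ.2) = confQet (qet c f) μ := by
  obtain ⟨_ | c₁, σ⟩ := μ <;> rfl

theorem expect_confQet_of_step (f : State B V n → ℝ≥0∞) {μ : Conf G B V n}
    {δ : SubDist (Conf G B V n)} (h : Step μ δ) : δ.expect (confQet f) = confQet f μ := by
  induction h generalizing f with
  | skip | assignB | assignN | apply => exact SubDist.expect_dirac _ _
  | meas x i s ρ =>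
    simp only [SubDist.expect_comb, SubDist.expect_dirac]
    exact (qet_meas_apply x i f (s, ρ)).symm
  | seq c₁ c₂ s ρ δ _ ih =>
    rw [SubDist.expect_map, funext (confQet_seqC c₂ f) (f := confQet f ∘ _), ih]
    rfl
  | iteTrue b c₁ c₂ s ρ hb =>
    rw [SubDist.expect_dirac]
    exact (mix_guard_of_true hb _ _).symm
  | iteFalse b c₁ c₂ s ρ hb =>
    rw [SubDist.expect_dirac]
    exact (mix_guard_of_false hb _ _).symm
  | loopTrue b c s ρ hb =>
    rw [SubDist.expect_dirac, confQet, confQet, qet_loop_eq_mix, mix_guard_of_true hb]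
    rfl
  | loopFalse b c s ρ hb =>
    rw [SubDist.expect_dirac, confQet, confQet, qet_loop_eq_mix, mix_guard_of_false hb]

/-- The weakest pre-expectation of `f` at a configuration, extending `qwp` by `f` at `↓`. -/
noncomputable def confWp (f : State B V n → ℝ≥0∞) : Conf G B V n → ℝ≥0∞ :=
  PARS.wp Step step_deterministic fun μ => f μ.2

theorem confWp_some (c : Stmt G B V n) (f : State B V n → ℝ≥0∞) (σ : State B V n) :
    confWp f (some c, σ) = qwp c f σ := rfl

theorem confWp_none (f : State B V n → ℝ≥0∞) (σ : State B V n) :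
    confWp (G := G) f (none, σ) = f σ :=
  PARS.wp_of_terminal _ _ ((terminal_step_iff _).2 rfl)

theorem confWp_of_step (f : State B V n → ℝ≥0∞) {μ : Conf G B V n} {δ : SubDist (Conf G B V n)}
    (h : Step μ δ) : confWp f μ = δ.expect (confWp f) :=
  PARS.wp_of_step _ _ h

theorem confWp_le {f : State B V n → ℝ≥0∞} {F : Conf G B V n → ℝ≥0∞}
    (hnone : ∀ σ, f σ ≤ F (none, σ)) (hstep : ∀ μ δ, Step μ δ → δ.expect F ≤ F μ) :
    confWp f ≤ F := by
  refine PARS.wp_le _ ?_ hstep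
  rintro ⟨c, σ⟩ h
  obtain rfl : c = none := (terminal_step_iff _).1 h
  exact hnone σ

theorem confWp_le_confQet (f : State B V n → ℝ≥0∞) : confWp (G := G) f ≤ confQet f :=
  confWp_le (fun _ => le_rfl) fun _ _ h => (expect_confQet_of_step f h).le

theorem qwp_qwp_le_qwp_seq (c₁ c₂ : Stmt G B V n) (f : State B V n → ℝ≥0∞) :
    qwp c₁ (qwp c₂ f) ≤ qwp (.seq c₁ c₂) f := by
  let F (μ : Conf G B V n) : ℝ≥0∞ := confWp f (some (seqC μ.1 c₂), μ.2)
  suffices confWp (qwp c₂ f) ≤ F from fun σ => this (some c₁, σ)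
  refine confWp_le (fun _ => le_rfl) ?_
  rintro ⟨_ | c, s, ρ⟩ δ hδ
  · cases hδ
  · calc δ.expect F = (δ.map fun μ => (some (seqC μ.1 c₂), μ.2)).expect (confWp f) :=
          (SubDist.expect_map _ _ _).symm
      _ ≤ F (some c, s, ρ) := (confWp_of_step f (.seq c c₂ s ρ δ hδ)).ge

theorem mix_qwp_loop_le (b : BExp B V) (c : Stmt G B V n) (f : State B V n → ℝ≥0∞) :
    mix (guard b) (qwp c (qwp (.loop b c) f)) f ≤ qwp (.loop b c) f := by
  rintro ⟨s, ρ⟩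
  cases hb : b.eval s
  · rw [mix_guard_of_false hb, ← confWp_some, confWp_of_step f (.loopFalse b c s ρ hb),
      SubDist.expect_dirac, confWp_none]
  · rw [mix_guard_of_true hb, ← confWp_some (.loop b c), confWp_of_step f (.loopTrue b c s ρ hb),
      SubDist.expect_dirac]
    exact qwp_qwp_le_qwp_seq c (.loop b c) f (s, ρ)

theorem confQet_le_confWp_of_step {f : State B V n → ℝ≥0∞} {μ : Conf G B V n}
    {δ : SubDist (Conf G B V n)} (h : Step μ δ)
    (hδ : δ.expect (confQet f) ≤ δ.expect (confWp f)) : confQet f μ ≤ confWp f μ := by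
  rwa [expect_confQet_of_step f h, ← confWp_of_step f h] at hδ

theorem confQet_le_confWp_of_step_dirac {f : State B V n → ℝ≥0∞} {μ ν : Conf G B V n}
    (h : Step μ (.dirac ν)) (hν : confQet f ν ≤ confWp f ν) : confQet f μ ≤ confWp f μ :=
  confQet_le_confWp_of_step h (by simpa only [SubDist.expect_dirac])

theorem qet_le_qwp (c : Stmt G B V n) (f : State B V n → ℝ≥0∞) : ⇑(qet c) f ≤ qwp c f := by
  induction c generalizing f with
  | skip =>
    exact fun σ => confQet_le_confWp_of_step_dirac (.skip σ.1 σ.2) (confWp_none f _).ge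
  | assignB x e =>
    exact fun σ => confQet_le_confWp_of_step_dirac (.assignB x e σ.1 σ.2) (confWp_none f _).ge
  | assignN x e =>
    exact fun σ => confQet_le_confWp_of_step_dirac (.assignN x e σ.1 σ.2) (confWp_none f _).ge
  | seq c₁ c₂ ih₁ ih₂ =>
    calc qet c₁ (qet c₂ f) ≤ qet c₁ (qwp c₂ f) := (qet c₁).monotone (ih₂ f)
      _ ≤ qwp c₁ (qwp c₂ f) := ih₁ _
      _ ≤ qwp (.seq c₁ c₂) f := qwp_qwp_le_qwp_seq c₁ c₂ f
  | ite b c₁ c₂ ih₁ ih₂ =>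
    rintro ⟨s, ρ⟩
    cases hb : b.eval s
    · exact confQet_le_confWp_of_step_dirac (.iteFalse b c₁ c₂ s ρ hb) (ih₂ f (s, ρ))
    · exact confQet_le_confWp_of_step_dirac (.iteTrue b c₁ c₂ s ρ hb) (ih₁ f (s, ρ))
  | loop b c ih =>
    refine OrderHom.lfp_le _ ?_
    calc mix (guard b) (qet c (qwp (.loop b c) f)) f
        ≤ mix (guard b) (qwp c (qwp (.loop b c) f)) f := mix_mono _ (ih _) le_rfl
      _ ≤ qwp (.loop b c) f := mix_qwp_loop_le b c f
  | apply g q =>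
    exact fun σ => confQet_le_confWp_of_step_dirac (.apply g q σ.1 σ.2) (confWp_none f _).ge
  | meas x i =>
    refine fun σ => confQet_le_confWp_of_step (.meas x i σ.1 σ.2) ?_
    simp only [SubDist.expect_comb, SubDist.expect_dirac, confWp_none, confQet, le_refl]

end QProg

theorem mainTheorem4 {G : QProg.GateSet} {B V : Type*} {n : ℕ}
    (c : QProg.Stmt G B V n) (f : QProg.State B V n → ENNReal) :
    QProg.qwp c f = QProg.qet c f :=
  le_antisymm (fun σ => QProg.confWp_le_confQet f (some c, σ)) (QProg.qet_le_qwp c f)
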